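/- Theorem 1. Let $\Omega=\mathbb C\setminus\{0,1\}$, let $\Delta$ be the open unit disc in $\mathbb C$, and for $p\in\Omega$ and $\xi\in\mathbb C$ let $$F_K^{\Omega}(p,\xi)=\inf\left\{\alpha>0 \;:\; \text{there is a holomorphic } f:\Delta\to\Omega \text{ with } f(0)=p \text{ and } \alpha f'(0)=\xi\right\}$$ denote the Kobayashi metric on $\Omega$ at the point $p$ in the direction $\xi$. Then there are constants $c,C>0$ and $\delta_0\in(0,1)$ such that for every $\delta\in(0,\delta_0)$ and every $p\in\mathbb C$ with $|p|=\delta$, $$\frac{c}{\delta\log(1/\delta)}\;\le\; F_K^{\Omega}(p,1)\;\le\;\frac{C}{\delta\log(1/\delta)}.$$ -/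

import Mathlib

/-- The Kobayashi pseudometric of `Ω` at the point `p` in the direction `ξ`: the infimum of all
`α > 0` for which there is a holomorphic map `f` from the open unit disc to `Ω` with `f 0 = p` and
`α • f' 0 = ξ`. The maps `f : ℂ → E` enter only through their restrictions to the unit disc. For
`Ω` open and `p ∈ Ω` the set below is non-empty, and it is always bounded below by `0`. -/
noncomputable def kobayashiMetric {E : Type*} [NormedAddCommGroup E] [NormedSpace ℂ E]
    (Ω : Set E) (p ξ : E) : ℝ :=
  sInf {α : ℝ | 0 < α ∧ ∃ f : ℂ → E,
    DifferentiableOn ℂ f (Metric.ball 0 1) ∧ Set.MapsTo f (Metric.ball 0 1) Ω ∧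
      f 0 = p ∧ (α : ℂ) • deriv f 0 = ξ}

open Metric Set Filter Topology

/-! Near the puncture 0, both bounds reflect that the punctured disc is covered by a half-plane via
`exp`. Lower bound: if `f` omits 0 and 1, write `f = exp g` with `g 0` the principal logarithm. Then
`g / (2πi)` omits every integer, and a Landau estimate linear in the value at 0 gives `|g'(0)| ≲
|g(0)| + 1 ≲ log (1/δ)`. Hence `|f'(0)| = |f(0)| |g'(0)| ≲ δ log (1/δ)`. The Landau estimate writes
a function omitting the integers as `cosh² G`; the image of `G` contains no disc of radius 3, so
Bloch's theorem bounds `G'(0)`. Upper bound: the covering of the punctured unit disc is an explicit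
competitor. -/

/-! ### Holomorphic logarithms -/

section Logarithm

/-- A zero-free holomorphic function on a disc has a holomorphic logarithm with prescribed value at
the centre. -/
theorem exists_differentiableOn_exp_eq_of_ball {f : ℂ → ℂ} {c w : ℂ} {r : ℝ} (hr : 0 < r)
    (hf : DifferentiableOn ℂ f (ball c r)) (h0 : ∀ z ∈ ball c r, f z ≠ 0)
    (hw : Complex.exp w = f c) :
    ∃ g : ℂ → ℂ, DifferentiableOn ℂ g (ball c r) ∧ g c = w ∧
      ∀ z ∈ ball c r, Complex.exp (g z) = f z := by
  have hc : c ∈ ball c r := mem_ball_self hr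
  have hd : DifferentiableOn ℂ (fun z => deriv f z / f z) (ball c r) :=
    (hf.deriv isOpen_ball).div hf h0
  obtain ⟨h, hh⟩ := hd.isExactOn_ball
  have hderiv : ∀ z ∈ ball c r,
      HasDerivAt (fun z => f z * Complex.exp (-h z)) 0 z := fun z hz => by
    have h1 := (hf.differentiableAt (isOpen_ball.mem_nhds hz)).hasDerivAt
    refine (h1.mul (hh z hz).neg.cexp).congr_deriv ?_
    have := h0 z hz
    simp only [Pi.neg_apply]
    field_simp
    ring
  refine ⟨fun z => h z - h c + w, fun z hz => ?_, by simp, fun z hz => ?_⟩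
  · exact (((hh z hz).differentiableAt.sub_const _).add_const _).differentiableWithinAt
  · have hconst : f z * Complex.exp (-h z) = f c * Complex.exp (-h c) :=
      (convex_ball c r).is_const_of_fderivWithin_eq_zero (𝕜 := ℂ)
        (fun x hx => (hderiv x hx).differentiableAt.differentiableWithinAt)
        (fun x hx => by
          rw [fderivWithin_of_isOpen isOpen_ball hx]
          ext
          simp [(hderiv x hx).deriv]) hz hc
    rw [Complex.exp_neg, Complex.exp_neg] at hconst
    have e1 := Complex.exp_ne_zero (h z)
    have e2 := Complex.exp_ne_zero (h c)
    have := h0 c hc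
    rw [Complex.exp_add, Complex.exp_sub, hw]
    field_simp at hconst ⊢
    rw [hconst]

end Logarithm

/-! ### Bloch's theorem -/

section Bloch

/-- If the derivative of `g` on a disc is at most twice its value at the centre, then the image of
the disc contains a disc of radius comparable to `t * ‖deriv g a‖`. -/
theorem ball_subset_image_of_norm_deriv_le {g : ℂ → ℂ} {a : ℂ} {t : ℝ} (ht : 0 < t)
    (hg : DifferentiableOn ℂ g (ball a t)) (ha : deriv g a ≠ 0)
    (hbound : ∀ z ∈ ball a t, ‖deriv g z‖ ≤ 2 * ‖deriv g a‖) :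
    ball (g a) (t * ‖deriv g a‖ / 24) ⊆ g '' ball a t := by
  set m := ‖deriv g a‖ with hm
  have hm0 : 0 < m := norm_pos_iff.2 ha
  have hat : a ∈ ball a t := mem_ball_self ht
  have hsub : closedBall a (t / 6) ⊆ ball a t := closedBall_subset_ball (by linarith)
  -- Schwarz lemma for `deriv g`, which stays within `3 * m` of its central value.
  have hdist : ∀ z ∈ ball a t, ‖deriv g z - deriv g a‖ ≤ 3 * m / t * ‖z - a‖ := by
    intro z hz
    have := Complex.dist_le_div_mul_dist_of_mapsTo_ball (R₂ := 3 * m)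
      (hg.deriv isOpen_ball) (fun x hx => ?_) hz
    · simpa [dist_eq_norm] using this
    · rw [mem_closedBall, dist_eq_norm]
      calc _ ≤ ‖deriv g x‖ + ‖deriv g a‖ := norm_sub_le _ _
        _ ≤ 2 * m + m := add_le_add (hbound x hx) le_rfl
        _ = _ := by ring
  -- At radius `t / 6` the Schwarz bound is `m / 2`, so the linear term still dominates the error.
  have hlin : ∀ z ∈ closedBall a (t / 6), ‖g z - g a - deriv g a * (z - a)‖ ≤
      m / 2 * ‖z - a‖ := by
    intro z hz
    have hD : ∀ x ∈ closedBall a (t / 6),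
        HasDerivAt (fun x => g x - deriv g a * x) (deriv g x - deriv g a) x := fun x hx => by
      have h1 := (hg.differentiableAt (isOpen_ball.mem_nhds (hsub hx))).hasDerivAt
      exact (h1.sub ((hasDerivAt_id x).const_mul (deriv g a))).congr_deriv (by rw [mul_one])
    have := (convex_closedBall a (t / 6)).norm_image_sub_le_of_norm_hasDerivWithin_le
      (C := m / 2) (fun x hx => (hD x hx).hasDerivWithinAt) (fun x hx => ?_)
      (mem_closedBall_self (by positivity)) hz
    · rwa [sub_sub_sub_comm, ← mul_sub] at this
    · refine (hdist x (hsub hx)).trans ?_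
      rw [mem_closedBall, dist_eq_norm] at hx
      calc 3 * m / t * ‖x - a‖ ≤ 3 * m / t * (t / 6) := by gcongr
        _ = m / 2 := by field_simp; norm_num
  have hsphere : ∀ z ∈ sphere a (t / 6), t * m / 12 ≤ ‖g z - g a‖ := by
    intro z hz
    have h1 := hlin z (sphere_subset_closedBall hz)
    have h2 : ‖z - a‖ = t / 6 := by simpa [dist_eq_norm] using hz
    have h3 : ‖deriv g a * (z - a)‖ ≤ ‖g z - g a‖ + ‖g z - g a - deriv g a * (z - a)‖ := by
      calc _ = ‖(g z - g a) - (g z - g a - deriv g a * (z - a))‖ := by congr 1; ring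
        _ ≤ _ := norm_sub_le _ _
    rw [norm_mul, ← hm] at h3
    rw [h2] at h1 h3
    nlinarith
  have hne : ∃ᶠ z in 𝓝 a, g z ≠ g a := by
    intro hcon
    have : g =ᶠ[𝓝 a] fun _ => g a := by
      filter_upwards [hcon] with z hz using not_not.1 hz
    exact ha (by rw [this.deriv_eq, deriv_const])
  have hcl : DiffContOnCl ℂ g (ball a (t / 6)) :=
    (hg.mono (closure_ball_subset_closedBall.trans hsub)).diffContOnCl
  have := hcl.ball_subset_image_closedBall (by positivity) hsphere hne
  rw [show t * m / 24 = t * m / 12 / 2 by ring]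
  exact this.trans (image_mono hsub)

/-- A weak form of Bloch's theorem: a holomorphic function on the unit disc whose image meets the
complement of every disc of radius `R` has derivative at most `96 * R` at the origin. -/
theorem norm_deriv_zero_le_of_forall_exists_notMem_image {g : ℂ → ℂ} {R : ℝ}
    (hg : DifferentiableOn ℂ g (ball 0 1))
    (hR : ∀ w : ℂ, ∃ v ∈ ball w R, v ∉ g '' ball 0 1) : ‖deriv g 0‖ ≤ 96 * R := by
  by_contra! hcon
  have hR0 : 0 < R := by
    obtain ⟨v, hv, -⟩ := hR 0
    exact pos_of_mem_ball hv
  have hsub : closedBall (0 : ℂ) (1 / 2) ⊆ ball 0 1 := closedBall_subset_ball (by norm_num)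
  -- At a maximum `a` of this weight, `deriv g` at most doubles on the disc of radius `t = (1/2 -
  -- ‖a‖) / 2`. The weight at 0 is `‖deriv g 0‖ / 2`, so `96 = 2 * 2 * 24`. Radius 1/2 gives
  -- compactness.
  have hcont : ContinuousOn (fun z : ℂ => (1 / 2 - ‖z‖) * ‖deriv g z‖) (closedBall 0 (1 / 2)) :=
    (continuousOn_const.sub continuousOn_id.norm).mul
      ((hg.deriv isOpen_ball).continuousOn.mono hsub).norm
  obtain ⟨a, ha, hmax⟩ := (isCompact_closedBall (0 : ℂ) (1 / 2)).exists_isMaxOn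
    ⟨0, mem_closedBall_self (by norm_num)⟩ hcont
  have hM := hmax (mem_closedBall_self (by norm_num : (0 : ℝ) ≤ 1 / 2))
  simp only [norm_zero, sub_zero, mem_ofPred_eq] at hM
  have hpos : 48 * R < (1 / 2 - ‖a‖) * ‖deriv g a‖ := by linarith
  have ha' : ‖a‖ ≤ 1 / 2 := by simpa using ha
  have hda : 0 < ‖deriv g a‖ := by
    rcases (norm_nonneg (deriv g a)).lt_or_eq with h | h
    · exact h
    · rw [← h] at hpos; linarith
  have hat : 0 < 1 / 2 - ‖a‖ := by
    by_contra! h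
    nlinarith
  set t := (1 / 2 - ‖a‖) / 2 with ht
  have ht0 : 0 < t := by positivity
  have hnorm : ∀ z ∈ ball a t, ‖z‖ < 1 / 2 - t := fun z hz => by
    have h1 : ‖z - a‖ < t := by simpa [dist_eq_norm] using hz
    have h2 : ‖z‖ ≤ ‖a‖ + ‖z - a‖ := by simpa using norm_add_le a (z - a)
    linarith
  have hballsub : ball a t ⊆ ball 0 1 := fun z hz => by
    have := hnorm z hz
    simp only [mem_ball_zero_iff]
    linarith
  have hbound : ∀ z ∈ ball a t, ‖deriv g z‖ ≤ 2 * ‖deriv g a‖ := fun z hz => by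
    have h1 := hnorm z hz
    have h2 := hmax (show z ∈ closedBall (0 : ℂ) (1 / 2) by simp; linarith)
    simp only [mem_ofPred_eq] at h2
    have h3 : t * ‖deriv g z‖ ≤ t * (2 * ‖deriv g a‖) := by
      calc _ ≤ (1 / 2 - ‖z‖) * ‖deriv g z‖ := by gcongr; linarith
        _ ≤ _ := h2
        _ = _ := by rw [ht]; ring
    exact le_of_mul_le_mul_left h3 ht0
  obtain ⟨v, hv, hv'⟩ := hR (g a)
  refine hv' (image_mono hballsub (ball_subset_image_of_norm_deriv_le ht0 (hg.mono hballsub)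
    (norm_pos_iff.1 hda) hbound (ball_subset_ball ?_ hv)))
  rw [ht]; linarith

end Bloch

/-! ### Landau's theorem -/

section Landau

/-- Every unit interval in the positive half-line has a point where `cosh ^ 2` is an integer. -/
theorem exists_cosh_sq_eq_intCast {x : ℝ} (hx : 0 ≤ x) :
    ∃ t ∈ Icc x (x + 1), ∃ n : ℤ, Real.cosh t ^ 2 = n := by
  have hsinh : ∀ y : ℝ, 0 ≤ y → y ≤ Real.sinh y := fun y hy => Real.self_le_sinh_iff.2 hy
  -- `cosh² (x + 1) ≥ cosh² x * cosh² 1 ≥ 2 cosh² x`, as `cosh² 1 = 1 + sinh² 1 ≥ 2`.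
  have hgap : Real.cosh x ^ 2 + 1 ≤ Real.cosh (x + 1) ^ 2 := by
    rw [Real.cosh_add]
    have h1 := hsinh 1 zero_le_one
    have h2 := Real.cosh_sq 1
    have h3 := Real.one_le_cosh x
    have h4 := Real.sinh_nonneg_iff.2 hx
    have h5 := Real.one_le_cosh 1
    have h6 : 0 ≤ Real.sinh x * Real.sinh 1 := by positivity
    have h7 : 0 ≤ Real.cosh x * Real.cosh 1 := by positivity
    have h8 : Real.cosh x ^ 2 * Real.cosh 1 ^ 2 ≤
        (Real.cosh x * Real.cosh 1 + Real.sinh x * Real.sinh 1) ^ 2 := by nlinarith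
    have h9 : 1 ≤ Real.cosh x ^ 2 := by nlinarith
    have h10 : 2 ≤ Real.cosh 1 ^ 2 := by nlinarith
    nlinarith
  have hmem : ((⌈Real.cosh x ^ 2⌉ : ℤ) : ℝ) ∈ Icc (Real.cosh x ^ 2) (Real.cosh (x + 1) ^ 2) :=
    ⟨Int.le_ceil _, (Int.ceil_lt_add_one _).le.trans hgap⟩
  obtain ⟨t, ht, hte⟩ := intermediate_value_Icc (by linarith : x ≤ x + 1)
    (Real.continuous_cosh.pow 2).continuousOn hmem
  exact ⟨t, ht, _, hte⟩

/-- Every disc of radius `3` contains a point where `cosh ^ 2` is an integer. -/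
theorem exists_mem_ball_cosh_sq_eq_intCast (w : ℂ) :
    ∃ v ∈ ball w 3, ∃ n : ℤ, Complex.cosh v ^ 2 = n := by
  obtain ⟨t, ht, n, hn⟩ : ∃ t : ℝ, |t - w.re| ≤ 1 ∧ ∃ n : ℤ, Real.cosh t ^ 2 = n := by
    rcases le_total 0 w.re with h | h
    · obtain ⟨t, ht, hn⟩ := exists_cosh_sq_eq_intCast h
      exact ⟨t, abs_le.2 ⟨by linarith [ht.1], by linarith [ht.2]⟩, hn⟩
    · obtain ⟨t, ht, hn⟩ := exists_cosh_sq_eq_intCast (neg_nonneg.2 h)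
      exact ⟨-t, abs_le.2 ⟨by linarith [ht.2], by linarith [ht.1]⟩, by simpa using hn⟩
  -- Shifting by `mπi` only changes the sign of `cosh`. The total offset is at most `1 + π / 2 < 3`.
  set m : ℤ := round (w.im / Real.pi)
  have hm : |m * Real.pi - w.im| ≤ Real.pi / 2 := by
    have h1 := abs_sub_round (w.im / Real.pi)
    have h2 : m * Real.pi - w.im = -((w.im / Real.pi - m) * Real.pi) := by
      field_simp; ring
    rw [h2, abs_neg, abs_mul, abs_of_pos Real.pi_pos]
    nlinarith [Real.pi_pos]
  refine ⟨t + m * Real.pi * Complex.I, ?_, n, ?_⟩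
  · rw [mem_ball, dist_eq_norm]
    refine (Complex.norm_le_abs_re_add_abs_im _).trans_lt ?_
    have := Real.pi_lt_d2
    simp
    linarith
  · have hs : Complex.sin (m * Real.pi) = 0 := Complex.sin_int_mul_pi m
    have hc : Complex.cos (m * Real.pi) ^ 2 = 1 := by
      have := Complex.sin_sq_add_cos_sq (m * Real.pi)
      simpa [hs] using this
    rw [Complex.cosh_add, Complex.cosh_mul_I, Complex.sinh_mul_I, hs, zero_mul, mul_zero, add_zero,
      mul_pow, hc, mul_one]
    exact_mod_cast hn

/-- **Landau's theorem** for functions omitting the integers. -/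
theorem norm_deriv_zero_le_of_ne_intCast {F : ℂ → ℂ} (hF : DifferentiableOn ℂ F (ball 0 1))
    (hint : ∀ z ∈ ball (0 : ℂ) 1, ∀ n : ℤ, F z ≠ n) :
    ‖deriv F 0‖ ≤ 288 * (‖F 0‖ + ‖F 0 - 1‖) := by
  have h0 : (0 : ℂ) ∈ ball (0 : ℂ) 1 := mem_ball_self one_pos
  have hF0 : ∀ z ∈ ball (0 : ℂ) 1, F z ≠ 0 := fun z hz => by simpa using hint z hz 0
  have hF1 : ∀ z ∈ ball (0 : ℂ) 1, F z - 1 ≠ 0 := fun z hz =>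
    sub_ne_zero.2 (by simpa using hint z hz 1)
  obtain ⟨a, had, -, ha⟩ := exists_differentiableOn_exp_eq_of_ball one_pos hF hF0
    (Complex.exp_log (hF0 0 h0))
  obtain ⟨b, hbd, -, hb⟩ := exists_differentiableOn_exp_eq_of_ball one_pos (hF.sub_const 1) hF1
    (Complex.exp_log (hF1 0 h0))
  -- With `A² = F` and `B² = F - 1`, the functions `A - B` and `A + B` are mutually inverse, so `A =
  -- cosh G` for a logarithm `G` of `A - B`.
  set A : ℂ → ℂ := fun z => Complex.exp (a z / 2) with hA
  set B : ℂ → ℂ := fun z => Complex.exp (b z / 2) with hB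
  have hA2 : ∀ z ∈ ball (0 : ℂ) 1, A z ^ 2 = F z := fun z hz => by
    rw [← ha z hz, hA, ← Complex.exp_nat_mul]; congr 1; push_cast; ring
  have hB2 : ∀ z ∈ ball (0 : ℂ) 1, B z ^ 2 = F z - 1 := fun z hz => by
    rw [← hb z hz, hB, ← Complex.exp_nat_mul]; congr 1; push_cast; ring
  have hprod : ∀ z ∈ ball (0 : ℂ) 1, (A z - B z) * (A z + B z) = 1 := fun z hz => by
    linear_combination hA2 z hz - hB2 z hz
  have hne : ∀ z ∈ ball (0 : ℂ) 1, A z - B z ≠ 0 := fun z hz =>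
    left_ne_zero_of_mul_eq_one (hprod z hz)
  obtain ⟨G, hGd, -, hG⟩ := exists_differentiableOn_exp_eq_of_ball one_pos
    (f := fun z => A z - B z) ((had.div_const 2).cexp.sub (hbd.div_const 2).cexp) hne
    (Complex.exp_log (hne 0 h0))
  have hcosh : ∀ z ∈ ball (0 : ℂ) 1, Complex.cosh (G z) ^ 2 = F z := fun z hz => by
    have h1 : Complex.exp (-G z) = A z + B z := by
      rw [Complex.exp_neg, hG z hz]
      exact inv_eq_of_mul_eq_one_right (hprod z hz)
    rw [Complex.cosh, h1, hG z hz, ← hA2 z hz]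
    ring
  have hG' : ‖deriv G 0‖ ≤ 96 * 3 := by
    refine norm_deriv_zero_le_of_forall_exists_notMem_image hGd fun w => ?_
    obtain ⟨v, hv, n, hn⟩ := exists_mem_ball_cosh_sq_eq_intCast w
    refine ⟨v, hv, ?_⟩
    rintro ⟨z, hz, rfl⟩
    exact hint z hz n (by rw [← hcosh z hz, hn])
  have hder : deriv F 0 = 2 * Complex.cosh (G 0) * Complex.sinh (G 0) * deriv G 0 := by
    have heq : F =ᶠ[𝓝 0] fun z => Complex.cosh (G z) ^ 2 := by
      filter_upwards [isOpen_ball.mem_nhds h0] with z hz using (hcosh z hz).symm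
    have h1 := (hGd.differentiableAt (isOpen_ball.mem_nhds h0)).hasDerivAt
    rw [heq.deriv_eq]
    refine ((h1.ccosh.pow 2).congr_deriv ?_).deriv
    push_cast
    ring
  have hc : ‖Complex.cosh (G 0)‖ ^ 2 = ‖F 0‖ := by rw [← norm_pow, hcosh 0 h0]
  have hs : ‖Complex.sinh (G 0)‖ ^ 2 = ‖F 0 - 1‖ := by
    rw [← norm_pow, Complex.sinh_sq, hcosh 0 h0]
  rw [hder, ← hc, ← hs]
  simp only [norm_mul, Complex.norm_ofNat]
  calc _ ≤ 2 * ‖Complex.cosh (G 0)‖ * ‖Complex.sinh (G 0)‖ * (96 * 3) := by gcongr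
    _ ≤ _ := by nlinarith [two_mul_le_add_sq ‖Complex.cosh (G 0)‖ ‖Complex.sinh (G 0)‖]

end Landau

/-! ### Discs in the twice-punctured plane -/

section PuncturedPlane

/-- Schottky-type estimate for the derivative of a function omitting `0` and `1`. -/
theorem norm_deriv_zero_le_of_mapsTo_compl_zero_one {f : ℂ → ℂ}
    (hf : DifferentiableOn ℂ f (ball 0 1)) (hmaps : MapsTo f (ball 0 1) ({0, 1}ᶜ : Set ℂ))
    (hsmall : ‖f 0‖ < Real.exp (-1)) :
    ‖deriv f 0‖ ≤ 1728 * Real.pi * (‖f 0‖ * Real.log (1 / ‖f 0‖)) := by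
  have h0 : (0 : ℂ) ∈ ball (0 : ℂ) 1 := mem_ball_self one_pos
  have hf0 : ∀ z ∈ ball (0 : ℂ) 1, f z ≠ 0 := fun z hz h => hmaps hz (by simp [h])
  have hf1 : ∀ z ∈ ball (0 : ℂ) 1, f z ≠ 1 := fun z hz h => hmaps hz (by simp [h])
  have hpos : 0 < ‖f 0‖ := norm_pos_iff.2 (hf0 0 h0)
  obtain ⟨g, hgd, hg0, hg⟩ := exists_differentiableOn_exp_eq_of_ball one_pos hf hf0
    (Complex.exp_log (hf0 0 h0))
  set L := Real.log (1 / ‖f 0‖) with hL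
  have hLlog : L = -Real.log ‖f 0‖ := by rw [hL, one_div, Real.log_inv]
  -- This absorbs the additive constants into `L`: `288 * (2L + 1) * 2π ≤ 1728πL`.
  have hL1 : 1 ≤ L := by
    have := (Real.log_lt_iff_lt_exp hpos).2 hsmall
    linarith
  have hpi := Real.pi_pos
  have hpi3 := Real.pi_gt_three
  have hnorm2pi : ‖2 * (Real.pi : ℂ) * Complex.I‖ = 2 * Real.pi := by
    simp [abs_of_pos hpi]
  have hLandau := norm_deriv_zero_le_of_ne_intCast
    (hgd.div_const (2 * Real.pi * Complex.I)) (fun z hz n hn => hf1 z hz (by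
      rw [div_eq_iff Complex.two_pi_I_ne_zero] at hn
      rw [← hg z hz, hn, Complex.exp_int_mul_two_pi_mul_I]))
  have hgnorm : ‖g 0‖ ≤ L + Real.pi := by
    rw [hg0]
    refine (Complex.norm_le_abs_re_add_abs_im _).trans ?_
    rw [Complex.log_re, Complex.log_im]
    refine add_le_add ?_ (Complex.abs_arg_le_pi _)
    rw [abs_of_nonpos (by linarith)]
    exact hLlog.ge
  have hderiv : deriv f 0 = f 0 * deriv g 0 := by
    have heq : f =ᶠ[𝓝 0] fun z => Complex.exp (g z) := by
      filter_upwards [isOpen_ball.mem_nhds h0] with z hz using (hg z hz).symm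
    have h1 := (hgd.differentiableAt (isOpen_ball.mem_nhds h0)).hasDerivAt
    rw [heq.deriv_eq, h1.cexp.deriv, hg 0 h0]
  rw [deriv_div_const, norm_div, hnorm2pi] at hLandau
  have hq : ‖g 0 / (2 * Real.pi * Complex.I)‖ = ‖g 0‖ / (2 * Real.pi) := by
    rw [norm_div, hnorm2pi]
  have hq1 : ‖g 0 / (2 * Real.pi * Complex.I) - 1‖ ≤ ‖g 0‖ / (2 * Real.pi) + 1 := by
    rw [← hq]; simpa using norm_sub_le (g 0 / (2 * Real.pi * Complex.I)) 1
  have hgd' : ‖deriv g 0‖ ≤ 1728 * Real.pi * L := by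
    rw [div_le_iff₀ (by positivity), hq] at hLandau
    have h2 : ‖g 0‖ / (2 * Real.pi) ≤ L := by
      rw [div_le_iff₀ (by positivity)]
      nlinarith
    calc _ ≤ _ := hLandau
      _ ≤ 288 * (L + (L + 1)) * (2 * Real.pi) := by gcongr; linarith
      _ ≤ _ := by nlinarith
  rw [hderiv, norm_mul]
  calc _ ≤ ‖f 0‖ * (1728 * Real.pi * L) := by gcongr
    _ = _ := by ring

/-- The universal covering of the punctured unit disc gives, through every point `p` of it, a
holomorphic disc with derivative `2 * p * log (1 / ‖p‖)` at the origin. -/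
theorem exists_mapsTo_compl_zero_one {p : ℂ} (hp : p ≠ 0) (hp1 : ‖p‖ < 1) :
    ∃ f : ℂ → ℂ, DifferentiableOn ℂ f (ball 0 1) ∧ MapsTo f (ball 0 1) ({0, 1}ᶜ : Set ℂ) ∧
      f 0 = p ∧ HasDerivAt f (2 * p * Real.log (1 / ‖p‖)) 0 := by
  have hpos : 0 < ‖p‖ := norm_pos_iff.2 hp
  set L := Real.log (1 / ‖p‖) with hL
  have hLlog : L = -Real.log ‖p‖ := by rw [hL, one_div, Real.log_inv]
  have hL0 : 0 < L := by linarith [Real.log_neg hpos hp1]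
  have hne : ∀ z ∈ ball (0 : ℂ) 1, 1 + z ≠ 0 := fun z hz h => by
    have : z = -1 := by linear_combination h
    simp [this] at hz
  -- `z / (1 + z)` maps the disc into `Re < 1/2`, so the modulus stays below `‖p‖ * exp L = 1`.
  have hder : ∀ z ∈ ball (0 : ℂ) 1, HasDerivAt (fun z => p * Complex.exp (2 * L * (z / (1 + z))))
      (p * (Complex.exp (2 * L * (z / (1 + z))) *
        (2 * L * ((1 * (1 + z) - z * 1) / (1 + z) ^ 2)))) z := fun z hz =>
    ((((hasDerivAt_id z).div ((hasDerivAt_id z).const_add 1) (hne z hz)).const_mul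
      (2 * (L : ℂ))).cexp).const_mul p
  refine ⟨fun z => p * Complex.exp (2 * L * (z / (1 + z))),
    fun z hz => (hder z hz).differentiableAt.differentiableWithinAt, fun z hz => ?_, by simp, ?_⟩
  · have hz' : Complex.normSq z < 1 := by
      have : ‖z‖ < 1 := by simpa using hz
      rw [Complex.normSq_eq_norm_sq]
      nlinarith [norm_nonneg z]
    have hN : 0 < Complex.normSq (1 + z) := Complex.normSq_pos.2 (hne z hz)
    have hre : (z / (1 + z)).re < 1 / 2 := by
      rw [Complex.div_re, ← add_div, div_lt_iff₀ hN]
      simp only [Complex.normSq_apply, Complex.add_re, Complex.add_im, Complex.one_re,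
        Complex.one_im] at hz' ⊢
      nlinarith
    have hlt : ‖p * Complex.exp (2 * L * (z / (1 + z)))‖ < 1 := by
      rw [norm_mul, Complex.norm_exp]
      have : (2 * (L : ℂ) * (z / (1 + z))).re = 2 * L * (z / (1 + z)).re := by
        rw [show (2 * (L : ℂ)) = ((2 * L : ℝ) : ℂ) by push_cast; ring, Complex.re_ofReal_mul]
      rw [this]
      calc _ < ‖p‖ * Real.exp L := by
            gcongr; nlinarith
        _ = 1 := by rw [hL, Real.exp_log (by positivity)]; field_simp
    rintro (h | h)
    · exact mul_ne_zero hp (Complex.exp_ne_zero _) h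
    · rw [mem_singleton_iff] at h
      simp only at h
      rw [h] at hlt
      simp at hlt
  · convert hder 0 (mem_ball_self one_pos) using 1
    simp
    ring

end PuncturedPlane

theorem theorem1 :
    ∃ c C δ₀ : ℝ, 0 < c ∧ 0 < C ∧ 0 < δ₀ ∧ δ₀ < 1 ∧
      ∀ δ : ℝ, 0 < δ → δ < δ₀ → ∀ p : ℂ, dist p 0 = δ →
        c * (1 / (δ * Real.log (1 / δ))) ≤ kobayashiMetric ({0, 1}ᶜ : Set ℂ) p 1 ∧
          kobayashiMetric ({0, 1}ᶜ : Set ℂ) p 1 ≤ C * (1 / (δ * Real.log (1 / δ))) := by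
  have hpi := Real.pi_pos
  have he1 : Real.exp (-1) < 1 := by simp
  refine ⟨1 / (1728 * Real.pi), 1 / 2, Real.exp (-1), by positivity, by norm_num,
    Real.exp_pos _, he1, fun δ hδ hδ' p hp => ?_⟩
  rw [dist_zero_right] at hp
  subst hp
  have hp0 : p ≠ 0 := norm_pos_iff.1 hδ
  have hL : 0 < Real.log (1 / ‖p‖) := by
    rw [one_div, Real.log_inv]
    linarith [Real.log_neg hδ (hδ'.trans he1)]
  set L := Real.log (1 / ‖p‖) with hLdef
  obtain ⟨f, hfd, hfm, hf0, hfder⟩ := exists_mapsTo_compl_zero_one hp0 (hδ'.trans he1)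
  have hmem : 1 / 2 * (1 / (‖p‖ * L)) ∈ {α : ℝ | 0 < α ∧ ∃ f : ℂ → ℂ,
      DifferentiableOn ℂ f (ball 0 1) ∧ MapsTo f (ball 0 1) ({0, 1}ᶜ : Set ℂ) ∧
        f 0 = p ∧ (α : ℂ) • deriv f 0 = 1} := by
    -- Rotate the disc so that the derivative at the origin becomes positive.
    set u : ℂ := ‖p‖ / p with hu
    have hu1 : ‖u‖ = 1 := by rw [hu, norm_div]; simp [hp0]
    have hrot : MapsTo (fun z => u * z) (ball (0 : ℂ) 1) (ball 0 1) := fun z hz => by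
      simpa [hu1] using hz
    refine ⟨by positivity, fun z => f (u * z),
      hfd.comp (differentiable_id.const_mul u).differentiableOn hrot, hfm.comp hrot,
      by simp [hf0], ?_⟩
    have hcomp : HasDerivAt (fun z => f (u * z)) (2 * p * L * u) 0 := by
      have h1 : HasDerivAt (fun z : ℂ => u * z) u 0 := by
        simpa using (hasDerivAt_id (0 : ℂ)).const_mul u
      exact HasDerivAt.comp (0 : ℂ) (by rwa [mul_zero]) h1
    have hLc : (L : ℂ) ≠ 0 := by exact_mod_cast hL.ne'
    have hpc : (‖p‖ : ℂ) ≠ 0 := by exact_mod_cast hδ.ne'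
    rw [hcomp.deriv, smul_eq_mul, hu]
    push_cast
    field_simp
  constructor
  · refine le_csInf ⟨_, hmem⟩ ?_
    rintro α ⟨hα, h, hhd, hhm, hh0, hhα⟩
    have hbound := norm_deriv_zero_le_of_mapsTo_compl_zero_one hhd hhm (by rwa [hh0])
    rw [hh0] at hbound
    have hnorm : α * ‖deriv h 0‖ = 1 := by
      have := congrArg norm hhα
      simpa [norm_smul, abs_of_pos hα] using this
    rw [one_div_mul_one_div, div_le_iff₀ (by positivity)]
    calc (1 : ℝ) = α * ‖deriv h 0‖ := hnorm.symm
      _ ≤ α * (1728 * Real.pi * (‖p‖ * L)) := by gcongr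
      _ = _ := by ring
  · exact csInf_le ⟨0, fun α hα => hα.1.le⟩ hmem
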